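/- For $n\ge 5$ let $T_n^2$ be the tree with vertex set $\{v_0,v_1,\ldots,v_{n-1}\}$ and edge set $\{v_0v_1,\ldots,v_0v_{n-3},\,v_{n-3}v_{n-2},\,v_{n-3}v_{n-1}\}$. For a graph $L$ and a positive integer $p$, let $ex(p;L)$ denote the maximal number of edges in a simple graph of order $p$ that contains no copy of $L$ as a (not necessarily induced) subgraph, and let $[x]$ be the greatest integer not exceeding $x$. **Theorem.** Let $p,n$ be positive integers with $p\ge n-1\ge 4$, and let $p=k(n-1)+r$, where $k$ is a positive integer and $r\in\{0,1,\ldots,n-2\}$. Then $$ex(p;T_n^2)=\max\left\{\left[\frac{(n-2)p}{2}\right]-(n-1+r),\ \frac{(n-2)p-r(n-1-r)}{2}\right\}$$ $$=\begin{cases}\left[\frac{(n-2)p}{2}\right]-(n-1+r) & \text{if } n\ge 16 \text{ and } 3\le r\le n-6, \text{ or if } 13\le n\le 15 \text{ and } 4\le r\le n-7,\\[4pt] \frac{(n-2)p-r(n-1-r)}{2} & \text{otherwise.}\end{cases}$$ -/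

import Mathlib

/-- The tree `T_n^2` (for `n ≥ 5`) on the vertices `v_0, …, v_{n-1}`, with edges
`v_0 v_1, …, v_0 v_{n-3}` and `v_{n-3} v_{n-2}`, `v_{n-3} v_{n-1}`.
Indices are compared additively, so that no truncated subtraction occurs;
`SimpleGraph.fromRel` symmetrizes the relation. -/
def treeT2 (n : ℕ) : SimpleGraph (Fin n) :=
  SimpleGraph.fromRel fun i j =>
    ((i : ℕ) = 0 ∧ 1 ≤ (j : ℕ) ∧ (j : ℕ) + 3 ≤ n) ∨
      ((i : ℕ) + 3 = n ∧ ((j : ℕ) + 2 = n ∨ (j : ℕ) + 1 = n))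

open Finset

/-! Put m = n - 1 and s = m - r. A copy of the tree is an edge ab with m - 3 further neighbours of a
and two further neighbours of b, all distinct, so in a tree-free graph a vertex of degree at least m
- 2 tightly restricts its neighbours. Hence (`exists_sparse_set_of_treeT2_free`) either all degrees
are at most m - 3, or some m or m - 1 vertices can be deleted at the cost of no more edges than a
clique on them would have. Induction on the order (`twice_card_edgeFinset_le_of_treeT2_free`) shows
that twice the edge count falls short of (m - 1)p by at least rs or at least 2(m + r).

Both bounds are attained, up to rounding: the first by k copies of K_m with a K_r, the second by k -
1 copies of K_m with an almost (m - 3)-regular graph on m + r vertices. The case distinction is the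
sign of rs - 2(m + r) = (r - 2)(s - 4) - 8. -/

/-! ### Finding the tree around an edge -/

theorem treeT2_isContained_of_double_star {V : Type*} [DecidableEq V] {G : SimpleGraph V} {n : ℕ}
    {a b : V} (hab : G.Adj a b) {X Y : Finset V} (hX : ∀ x ∈ X, G.Adj a x ∧ x ≠ b)
    (hY : ∀ y ∈ Y, G.Adj b y ∧ y ≠ a) (hXY : Disjoint X Y) (hXc : #X + 4 = n) (hYc : #Y = 2) :
    (treeT2 n).IsContained G := by
  subst hXc
  obtain ⟨y, z, hyz, rfl⟩ := card_eq_two.1 hYc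
  let e := X.equivFin.symm
  have he : ∀ k, G.Adj a (e k) ∧ (e k : V) ≠ b := fun k => hX _ (e k).2
  have hea : ∀ k, (e k : V) ≠ a := fun k h => G.loopless.irrefl a (by simpa [h] using (he k).1)
  have hey : ∀ k, (e k : V) ≠ y := fun k h => by
    have := (e k).2
    rw [h] at this
    exact disjoint_left.1 hXY this (by simp)
  have hez : ∀ k, (e k : V) ≠ z := fun k h => by
    have := (e k).2
    rw [h] at this
    exact disjoint_left.1 hXY this (by simp)
  have hei : ∀ k l, (e k : V) = e l → k = l := fun k l h => e.injective (Subtype.ext h)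
  have hy := hY y (by simp)
  have hz := hY z (by simp)
  have hne := hab.ne
  have hyb := hy.1.ne
  have hzb := hz.1.ne
  let f : Fin (#X + 4) → V := fun i =>
    if h0 : (i : ℕ) = 0 then a
    else if h1 : (i : ℕ) ≤ #X then e ⟨i - 1, by omega⟩
    else if (i : ℕ) = #X + 1 then b
    else if (i : ℕ) = #X + 2 then y
    else z
  have key : ∀ i j : Fin (#X + 4), (((i : ℕ) = 0 ∧ 1 ≤ (j : ℕ) ∧ (j : ℕ) + 3 ≤ #X + 4) ∨
      ((i : ℕ) + 3 = #X + 4 ∧ ((j : ℕ) + 2 = #X + 4 ∨ (j : ℕ) + 1 = #X + 4))) →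
      G.Adj (f i) (f j) := by
    intro i j h
    rcases h with ⟨h0, h1, h2⟩ | ⟨h0, h1⟩
    · have hi : f i = a := by simp only [f]; rw [dif_pos h0]
      rw [hi]
      by_cases hj : (j : ℕ) ≤ #X
      · have : f j = e ⟨j - 1, by omega⟩ := by
          simp only [f]; rw [dif_neg (by omega), dif_pos hj]
        rw [this]; exact (he _).1
      · have : f j = b := by
          simp only [f]; rw [dif_neg (by omega), dif_neg (by omega), if_pos (by omega)]
        rw [this]; exact hab
    · have hi : f i = b := by
        simp only [f]; rw [dif_neg (by omega), dif_neg (by omega), if_pos (by omega)]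
      rw [hi]
      rcases h1 with h1 | h1
      · have : f j = y := by
          simp only [f]
          rw [dif_neg (by omega), dif_neg (by omega), if_neg (by omega), if_pos (by omega)]
        rw [this]; exact hy.1
      · have : f j = z := by
          simp only [f]
          rw [dif_neg (by omega), dif_neg (by omega), if_neg (by omega), if_neg (by omega)]
        rw [this]; exact hz.1
  refine ⟨⟨⟨f, ?_⟩, ?_⟩⟩
  · intro i j hij
    rw [treeT2, SimpleGraph.fromRel_adj] at hij
    rcases hij.2 with h | h
    · exact key i j h
    · exact (key j i h).symm
  · intro i j hij
    change f i = f j at hij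
    simp only [f] at hij
    ext
    split_ifs at hij
    all_goals first
      | omega
      | exact absurd hij (he _).2
      | exact absurd hij.symm (he _).2
      | exact absurd hij (hea _)
      | exact absurd hij.symm (hea _)
      | exact absurd hij (hey _)
      | exact absurd hij.symm (hey _)
      | exact absurd hij (hez _)
      | exact absurd hij.symm (hez _)
      | (have := congrArg Fin.val (hei _ _ hij); simp only at this; omega)
      | (exfalso; grind)

open Classical in
/-- A sufficient condition, in terms of cardinalities, for an edge to be the central edge of a
copy of `treeT2`. -/
theorem treeT2_isContained_of_adj {V : Type*} [Fintype V] {G : SimpleGraph V} {n : ℕ}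
    (hn : 4 ≤ n) {a b : V} (hab : G.Adj a b)
    (ha : n ≤ #(G.neighborFinset a \ {b}) + 4)
    (hb : 2 ≤ #(G.neighborFinset b \ {a}))
    (hu : n ≤ #((G.neighborFinset a \ {b}) ∪ (G.neighborFinset b \ {a})) + 2) :
    (treeT2 n).IsContained G := by
  set A := G.neighborFinset a \ {b} with hA
  set B := G.neighborFinset b \ {a} with hB
  have hAB : #(A ∪ B) = #A + #(B \ A) := by
    rw [← card_union_of_disjoint disjoint_sdiff, union_sdiff_self_eq_union]
  obtain ⟨Y, hYB, hYc, hYA⟩ : ∃ Y ⊆ B, #Y = 2 ∧ n ≤ #(A \ Y) + 4 := by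
    -- The two leaves at b are taken outside A as far as possible, so that A loses as little as it
    -- can.
    rcases le_total 2 #(B \ A) with h | h
    · obtain ⟨Y, hY, hc⟩ := exists_subset_card_eq h
      refine ⟨Y, hY.trans sdiff_subset, hc, ?_⟩
      rwa [sdiff_eq_self_of_disjoint]
      exact disjoint_of_subset_right hY disjoint_sdiff
    · obtain ⟨Y, hY, hYB, hc⟩ := exists_subsuperset_card_eq (sdiff_subset (s := B) (t := A)) h hb
      refine ⟨Y, hYB, hc, ?_⟩
      have h1 : #(A \ Y) + #(Y ∩ A) = #A := by
        rw [inter_comm]; exact card_sdiff_add_card_inter A Y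
      have h2 : #(Y \ A) + #(Y ∩ A) = #Y := card_sdiff_add_card_inter Y A
      have h3 : #(B \ A) ≤ #(Y \ A) := card_le_card fun x hx => by
        have := hY hx
        simp only [mem_sdiff] at hx ⊢
        exact ⟨this, hx.2⟩
      omega
  obtain ⟨X, hX, hXc⟩ := exists_subset_card_eq (show n - 4 ≤ #(A \ Y) by omega)
  refine treeT2_isContained_of_double_star (X := X) (Y := Y) hab ?_ ?_ ?_ (by omega) hYc
  · intro x hx
    have := hX hx
    simpa [hA] using (mem_sdiff.1 this).1
  · intro y hy
    simpa [hB] using hYB hy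
  · exact disjoint_of_subset_left hX sdiff_disjoint

/-! ### Upper bound: sparse sets and induction -/

open Classical in
-- Sum the degrees: an edge between S and its complement is counted once from each end, and the
-- outer end is charged to S by double counting.
theorem twice_card_edgeFinset_eq_induce_compl_add {V : Type*} [Fintype V] (G : SimpleGraph V)
    (S : Finset V) :
    2 * #G.edgeFinset = 2 * #(G.induce {v | v ∉ S}).edgeFinset +
      ∑ v ∈ S, (G.degree v + #(G.neighborFinset v \ S)) := by
  rw [← SimpleGraph.sum_degrees_eq_twice_card_edges,
    ← SimpleGraph.sum_degrees_eq_twice_card_edges]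
  have h1 : ∑ v, (G.induce {v | v ∉ S}).degree v = ∑ v ∈ Sᶜ, #(G.neighborFinset v \ S) := by
    rw [sum_subtype (p := fun v => v ∈ {v | v ∉ S}) Sᶜ (fun x => by simp)]
    refine sum_congr rfl fun v _ => ?_
    rw [← SimpleGraph.card_neighborFinset_eq_degree,
      ← card_map (Function.Embedding.subtype (fun v => v ∈ {v | v ∉ S}))]
    congr 1
    ext w
    simp [and_comm]
  have h2 : ∑ v ∈ Sᶜ, #(G.neighborFinset v ∩ S) = ∑ v ∈ S, #(G.neighborFinset v \ S) := by
    have := sum_card_bipartiteAbove_eq_sum_card_bipartiteBelow (s := Sᶜ) (t := S) G.Adj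
    convert this using 3 with v hv v hv
    · ext w; simp [bipartiteAbove, and_comm]
    · ext w; simp [bipartiteBelow, and_comm, G.adj_comm]
  have h3 : ∑ v ∈ Sᶜ, G.degree v =
      ∑ v ∈ Sᶜ, #(G.neighborFinset v \ S) + ∑ v ∈ Sᶜ, #(G.neighborFinset v ∩ S) := by
    rw [← sum_add_distrib]
    exact sum_congr rfl fun v _ => (card_sdiff_add_card_inter _ _).symm
  rw [h1, ← sum_add_sum_compl S, h3, h2, sum_add_distrib]
  ring

open Classical in
-- Otherwise the neighbours of a and b, apart from a and b themselves, number at least m - 1, enough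
-- to make ab the central edge of a copy.
theorem degree_add_card_sdiff_lt_of_treeT2_free {V : Type*} [Fintype V] {G : SimpleGraph V} {m : ℕ}
    (hm : 4 ≤ m) (hG : (treeT2 (m + 1)).Free G) {a b : V} (hab : G.Adj a b)
    (ha : m ≤ G.degree a + 2) (hb : 3 ≤ G.degree b) :
    G.degree a + #(G.neighborFinset b \ insert a (G.neighborFinset a)) < m := by
  by_contra hlt
  push Not at hlt
  have hA : #(G.neighborFinset a \ {b}) + 1 = G.degree a := by
    rw [sdiff_singleton_eq_erase, card_erase_add_one (by simpa), G.card_neighborFinset_eq_degree]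
  have hB : #(G.neighborFinset b \ {a}) + 1 = G.degree b := by
    rw [sdiff_singleton_eq_erase, card_erase_add_one (by simpa using hab.symm),
      G.card_neighborFinset_eq_degree]
  refine hG (treeT2_isContained_of_adj (by omega) hab (by omega) (by omega) ?_)
  have hd : Disjoint (G.neighborFinset a \ {b})
      (G.neighborFinset b \ insert a (G.neighborFinset a)) := by
    rw [disjoint_left]
    intro x hx hx'
    simp at hx hx'
    tauto
  have : #((G.neighborFinset a \ {b}) ∪ (G.neighborFinset b \ insert a (G.neighborFinset a))) ≤
      #((G.neighborFinset a \ {b}) ∪ (G.neighborFinset b \ {a})) := by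
    refine card_le_card (union_subset_union subset_rfl (sdiff_subset_sdiff subset_rfl ?_))
    simp
  rw [card_union_of_disjoint hd] at this
  omega

open Classical in
theorem card_neighborFinset_sdiff_lt {V : Type*} [Fintype V] {G : SimpleGraph V}
    {a b : V} (hab : G.Adj a b) {S : Finset V} (ha : a ∈ S) :
    #(G.neighborFinset b \ S) < G.degree b := by
  rw [← G.card_neighborFinset_eq_degree]
  refine card_lt_card ((ssubset_iff_of_subset sdiff_subset).2 ⟨a, ?_, ?_⟩)
  · simpa using hab.symm
  · simp [ha]

open Classical in
/-- A graph without a copy of `treeT2 (m + 1)` either has small maximum degree, or has a set of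
`m` or `m - 1` vertices meeting few edges. -/
theorem exists_sparse_set_of_treeT2_free {V : Type*} [Fintype V] {G : SimpleGraph V} {m : ℕ}
    (hm : 4 ≤ m) (hG : (treeT2 (m + 1)).Free G) :
    (∀ v, G.degree v + 3 ≤ m) ∨ ∃ S : Finset V, (#S = m ∨ #S + 1 = m) ∧
      ∀ v ∈ S, G.degree v + #(G.neighborFinset v \ S) + 1 ≤ #S := by
  have key := fun {a b : V} => degree_add_card_sdiff_lt_of_treeT2_free (a := a) (b := b) hm hG
  by_cases hbig : ∃ a, m ≤ G.degree a
  · right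
    obtain ⟨a, ha⟩ := hbig
    have h2 : ∀ b, G.Adj a b → G.degree b ≤ 2 := fun b hb => by
      by_contra h
      have := key hb (by omega) (by omega)
      omega
    -- Degree 2 only gives 2 + 2 + 1 ≤ 5, too weak for m = 4. There a neighbour b of degree 2 = m -
    -- 2 can itself play v_0, with a as the vertex of degree 3.
    have h1 : m = 4 → ∀ b, G.Adj a b → G.degree b ≤ 1 := fun h4 b hb => by
      by_contra h
      have h3 := h2 b hb
      have := key hb.symm (by omega) (by omega)
      have hc : #(G.neighborFinset a) ≤
          #(G.neighborFinset a \ insert b (G.neighborFinset b)) +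
            #(insert b ((G.neighborFinset b).erase a)) := by
        rw [← card_sdiff_add_card_inter (G.neighborFinset a) (insert b (G.neighborFinset b))]
        refine Nat.add_le_add_left (card_le_card fun x hx => ?_) _
        have : x ≠ a := by rintro rfl; simp at hx
        simp at hx ⊢
        tauto
      have hi := card_insert_le b ((G.neighborFinset b).erase a)
      rw [card_erase_of_mem (by simpa using hb.symm)] at hi
      rw [G.card_neighborFinset_eq_degree] at hc hi
      omega
    obtain ⟨S, hS, hSc⟩ := exists_subset_card_eq
      (show m ≤ #(G.neighborFinset a) by rwa [G.card_neighborFinset_eq_degree])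
    refine ⟨S, Or.inl hSc, fun v hv => ?_⟩
    have hav : G.Adj a v := by simpa using hS hv
    have hle : #(G.neighborFinset v \ S) ≤ G.degree v := by
      rw [← G.card_neighborFinset_eq_degree]; exact card_le_card sdiff_subset
    have := h2 v hav
    rcases eq_or_lt_of_le hm with h4 | h5
    · have := h1 h4.symm v hav
      omega
    · omega
  push Not at hbig
  have hcard : ∀ a, #(insert a (G.neighborFinset a)) = G.degree a + 1 := fun a => by
    rw [card_insert_of_notMem (by simp), G.card_neighborFinset_eq_degree]
  have hself : ∀ a, #(G.neighborFinset a \ insert a (G.neighborFinset a)) = 0 := fun a => by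
    rw [card_eq_zero, sdiff_eq_empty_iff_subset]; exact subset_insert _ _
  by_cases hmid : ∃ a, G.degree a + 1 = m
  · right
    obtain ⟨a, ha⟩ := hmid
    refine ⟨insert a (G.neighborFinset a), Or.inl (by rw [hcard, ha]), fun v hv => ?_⟩
    rw [hcard]
    rcases mem_insert.1 hv with rfl | hv
    · rw [hself]
    have hav : G.Adj a v := by simpa using hv
    have h1 := card_neighborFinset_sdiff_lt hav (mem_insert_self a (G.neighborFinset a))
    have := hbig v
    by_cases h3 : 3 ≤ G.degree v
    · have := key hav (by omega) h3
      omega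
    · omega
  have hbig2 : ∀ a, G.degree a + 2 ≤ m := fun a => by
    have h1 := hbig a
    have : G.degree a + 1 ≠ m := fun h => hmid ⟨a, h⟩
    omega
  have hout : ∀ a b, G.Adj a b → G.degree a + 2 = m →
      #(G.neighborFinset b \ insert a (G.neighborFinset a)) ≤ 1 := fun a b hab ha => by
    by_cases h3 : 3 ≤ G.degree b
    · have := key hab (by omega) h3
      omega
    · have h1 := card_neighborFinset_sdiff_lt hab (mem_insert_self a (G.neighborFinset a))
      omega
  by_cases hsmall : ∃ a, G.degree a + 2 = m
  swap
  · left
    intro v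
    have h1 := hbig2 v
    have : G.degree v + 2 ≠ m := fun h => hsmall ⟨v, h⟩
    omega
  right
  obtain ⟨a, ha⟩ := hsmall
  -- The closed neighbourhood of a has m - 1 vertices and fails only if a neighbour b of degree m -
  -- 2 has a neighbour w outside; adding w then gives m vertices and one unit of slack.
  by_cases hb : ∃ b, G.Adj a b ∧ G.degree b + 2 = m ∧
      (G.neighborFinset b \ insert a (G.neighborFinset a)).Nonempty
  · obtain ⟨b, hab, hbd, w, hw⟩ := hb
    have hw' := mem_sdiff.1 hw
    have hbw : G.Adj b w := by simpa using hw'.1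
    have hSc : #(insert w (insert a (G.neighborFinset a))) = m := by
      rw [card_insert_of_notMem hw'.2, hcard]; omega
    refine ⟨_, Or.inl hSc, fun v hv => ?_⟩
    rw [hSc]
    have hmono : #(G.neighborFinset v \ insert w (insert a (G.neighborFinset a))) ≤
        #(G.neighborFinset v \ insert a (G.neighborFinset a)) :=
      card_le_card (sdiff_subset_sdiff subset_rfl (subset_insert _ _))
    have hv2 := hbig2 v
    rcases mem_insert.1 hv with rfl | hv
    · have h1 := hout b v hbw hbd
      -- As w is the only neighbour of b outside, the closed neighbourhood of b lies in S, so the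
      -- bound around b also controls w.
      have hsub : insert b (G.neighborFinset b) ⊆ insert v (insert a (G.neighborFinset a)) := by
        intro x hx
        rcases mem_insert.1 hx with rfl | hx
        · simp [hab]
        · by_contra hxn
          rw [mem_insert, not_or] at hxn
          exact hxn.1 (card_le_one.1 (hout a b hab ha) x (mem_sdiff.2 ⟨hx, hxn.2⟩) v hw)
      have := card_le_card (sdiff_subset_sdiff (subset_refl (G.neighborFinset v)) hsub)
      omega
    · rcases mem_insert.1 hv with rfl | hv
      · have := hself v
        omega
      · have := hout a v (by simpa using hv) ha
        omega
  · have hSc := hcard a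
    refine ⟨insert a (G.neighborFinset a), Or.inr (by omega), fun v hv => ?_⟩
    rw [hcard]
    rcases mem_insert.1 hv with rfl | hv
    · rw [hself]
    have hav : G.Adj a v := by simpa using hv
    have h1 := hout a v hav ha
    have h2 := hbig2 v
    rcases Nat.eq_zero_or_pos #(G.neighborFinset v \ insert a (G.neighborFinset a)) with h0 | h0
    · omega
    · have : G.degree v + 2 ≠ m := fun h => hb ⟨v, hav, h, card_pos.1 h0⟩
      omega

/-- The arithmetic of removing a sparse set of `c` vertices from a graph with `p + c` vertices. -/
theorem edge_bound_add_sparse_set {m k r s p c E e : ℕ} (hs : 1 ≤ s) (hrs : r + s = m)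
    (hk : 1 ≤ k) (hc : c = m ∨ c + 1 = m) (hE : 2 * E + c ≤ 2 * e + c * c)
    (hp : p + c = k * m + r)
    (ih : ∀ k r s, 1 ≤ s → r + s = m → p = k * m + r →
      2 * e + r * s + p ≤ m * p ∨ 1 ≤ k ∧ 2 * e + 2 * (m + r) + p ≤ m * p) :
    2 * E + r * s + (p + c) ≤ m * (p + c) ∨
      1 ≤ k ∧ 2 * E + 2 * (m + r) + (p + c) ≤ m * (p + c) := by
  obtain ⟨k, rfl⟩ : ∃ j, k = j + 1 := ⟨k - 1, by omega⟩
  have hkm : (k + 1) * m = k * m + m := by ring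
  rw [mul_add]
  rcases hc with rfl | rfl
  · rcases ih k r s hs hrs (by omega) with h | ⟨_, h⟩
    · left; omega
    · right; omega
  · have hcc : (c + 1) * c = c * c + c := by ring
    -- Deleting m - 1 vertices raises the residue by one; for s = 1 it wraps round to 0 and the
    -- quotient does not drop.
    rcases eq_or_lt_of_le hs with rfl | hs1
    · obtain rfl : r = c := by omega
      rcases ih (k + 1) 0 (r + 1) (by omega) (by omega) (by omega) with h | ⟨_, h⟩ <;>
      · left; omega
    · obtain ⟨t, rfl⟩ : ∃ t, s = t + 1 := ⟨s - 1, by omega⟩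
      have e1 : r * (t + 1) = r * t + r := by ring
      have e2 : (r + 1) * t = r * t + t := by ring
      rcases ih k (r + 1) t (by omega) (by omega) (by omega) with h | ⟨_, h⟩
      · left; omega
      · right; omega

open Classical in
theorem twice_card_edgeFinset_le_of_treeT2_free {m : ℕ} (hm : 4 ≤ m) {V : Type*} [Fintype V]
    {G : SimpleGraph V} (hG : (treeT2 (m + 1)).Free G) {k r s : ℕ} (hs : 1 ≤ s) (hrs : r + s = m)
    (hV : Fintype.card V = k * m + r) :
    2 * #G.edgeFinset + r * s + Fintype.card V ≤ m * Fintype.card V ∨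
      1 ≤ k ∧ 2 * #G.edgeFinset + 2 * (m + r) + Fintype.card V ≤ m * Fintype.card V := by
  induction h : Fintype.card V using Nat.strong_induction_on generalizing V k r s with
  | _ p ih =>
  rw [h] at hV
  have hdeg : ∀ c, (∀ v, G.degree v ≤ c) → 2 * #G.edgeFinset ≤ p * c := fun c hc => by
    rw [← G.sum_degrees_eq_twice_card_edges, ← h, ← smul_eq_mul, ← card_univ]
    exact sum_le_card_nsmul _ _ _ fun v _ => hc v
  rcases Nat.eq_zero_or_pos k with rfl | hk
  · left
    have hpr : p = r := by simpa using hV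
    have := hdeg (p - 1) fun v => by have := G.degree_lt_card_verts v; omega
    subst hpr hrs
    rcases Nat.eq_zero_or_pos p with rfl | hp0
    · simpa using this
    obtain ⟨q, rfl⟩ : ∃ q, p = q + 1 := ⟨p - 1, by omega⟩
    simp only [Nat.add_sub_cancel] at this
    linarith
  -- Degrees at most m - 3 save 2p against (m - 1)p, and p ≥ m + r because k ≥ 1.
  rcases exists_sparse_set_of_treeT2_free hm hG with hsm | ⟨S, hSc, hS⟩
  · right
    refine ⟨hk, ?_⟩
    have h1 := hdeg (m - 3) fun v => by have := hsm v; omega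
    have h2 : m ≤ k * m := Nat.le_mul_of_pos_left m hk
    obtain ⟨l, rfl⟩ : ∃ l, m = l + 3 := ⟨m - 3, by omega⟩
    simp only [Nat.add_sub_cancel] at h1
    have h3 : (l + 3) * p = p * l + 3 * p := by ring
    omega
  have hfree : (treeT2 (m + 1)).Free (G.induce {v | v ∉ S}) := fun hc =>
    hG (hc.trans ⟨SimpleGraph.Copy.induce G _⟩)
  have hcS : Fintype.card {v | v ∉ S} + #S = p := by
    rw [← h, ← card_compl_add_card S]
    exact congrArg (· + #S) (Fintype.card_of_subtype Sᶜ fun x => by simp)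
  have he := twice_card_edgeFinset_eq_induce_compl_add G S
  have hsum : ∑ v ∈ S, (G.degree v + #(G.neighborFinset v \ S)) + #S ≤ #S * #S := by
    rw [← smul_eq_mul, card_eq_sum_ones, ← sum_add_distrib, ← card_eq_sum_ones]
    exact sum_le_card_nsmul _ _ _ fun v hv => hS v hv
  have ih' := fun k r s h1 h2 h3 =>
    ih (Fintype.card {v | v ∉ S}) (by omega) hfree (k := k) (r := r) (s := s) h1 h2 h3 rfl
  rw [← hcS]
  refine edge_bound_add_sparse_set (e := #(G.induce {v | v ∉ S}).edgeFinset) hs hrs hk hSc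
    (by omega) (by omega) fun k r s h1 h2 h3 => ?_
  convert ih' k r s h1 h2 h3

/-! ### Lower bound: tree-free graphs -/

theorem treeT2_adj_zero {n : ℕ} {i j : Fin n} (hi : (i : ℕ) = 0) (h1 : 1 ≤ (j : ℕ))
    (h3 : (j : ℕ) + 3 ≤ n) : (treeT2 n).Adj i j := by
  rw [treeT2, SimpleGraph.fromRel_adj]
  exact ⟨fun h => by subst h; omega, Or.inl (Or.inl ⟨hi, h1, h3⟩)⟩

theorem treeT2_ne_bot {m : ℕ} (hm : 3 ≤ m) : treeT2 (m + 1) ≠ ⊥ := fun h => by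
  have := treeT2_adj_zero (n := m + 1) (i := 0) (j := ⟨1, by omega⟩) rfl le_rfl (by simp; omega)
  rw [h] at this
  exact this

theorem treeT2_adj_right {n : ℕ} {i j : Fin n} (hi : (i : ℕ) + 3 = n) (hj : n < (j : ℕ) + 3) :
    (treeT2 n).Adj i j := by
  rw [treeT2, SimpleGraph.fromRel_adj]
  exact ⟨fun h => by subst h; omega, Or.inl (Or.inr ⟨hi, by omega⟩)⟩

/-- An injective homomorphism from `treeT2 (m + 1)` to a disjoint union with a complete graph on
`m` vertices lands in the other summand. -/
theorem treeT2_free_sum_top {V : Type*} {G : SimpleGraph V} {m : ℕ} (hm : 3 ≤ m)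
    (hG : (treeT2 (m + 1)).Free G) :
    (treeT2 (m + 1)).Free (G ⊕g (⊤ : SimpleGraph (Fin m))) := by
  rintro ⟨f⟩
  have hadj : ∀ i j, (treeT2 (m + 1)).Adj i j → (f i).isLeft = (f j).isLeft := fun i j hij => by
    have := f.toHom.map_adj hij
    simp only [SimpleGraph.Copy.coe_toHom] at this
    revert this
    rcases f i with x | x <;> rcases f j with y | y <;> simp
  have hside : ∀ i, (f 0).isLeft = (f i).isLeft := fun i => by
    rcases Nat.eq_zero_or_pos (i : ℕ) with h | h
    · rw [show i = 0 from Fin.ext h]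
    by_cases h3 : (i : ℕ) + 3 ≤ m + 1
    · exact hadj _ _ (treeT2_adj_zero rfl h h3)
    · rw [hadj 0 ⟨m - 2, by omega⟩ (treeT2_adj_zero rfl (by simp; omega) (by simp; omega))]
      exact hadj _ _ (treeT2_adj_right (by simp; omega) (by omega))
  rcases h0 : f 0 with x | x
  · have hl : ∀ i, ∃ y, f i = Sum.inl y := fun i => by
      have := hside i
      rw [h0] at this
      exact Sum.isLeft_iff.1 this.symm
    choose g hg using hl
    refine hG ⟨⟨⟨g, fun {i j} hij => ?_⟩, fun i j hij => f.injective ?_⟩⟩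
    · have := f.toHom.map_adj hij
      simpa only [SimpleGraph.Copy.coe_toHom, hg, SimpleGraph.sum_adj_inl] using this
    · change g i = g j at hij
      simp only [SimpleGraph.Copy.coe_toHom, hg, hij]
  · have hr : ∀ i, ∃ y, f i = Sum.inr y := fun i => by
      have := hside i
      rw [h0] at this
      exact Sum.isRight_iff.1 (by simpa using this.symm)
    choose g hg using hr
    have hinj : Function.Injective g := fun i j hij => f.injective (by
      simp only [SimpleGraph.Copy.coe_toHom, hg, hij])
    simpa using Fintype.card_le_of_injective g hinj

theorem extremalNumber_treeT2_add {m : ℕ} (hm : 3 ≤ m) (q : ℕ) :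
    SimpleGraph.extremalNumber q (treeT2 (m + 1)) + m.choose 2 ≤
      SimpleGraph.extremalNumber (q + m) (treeT2 (m + 1)) := by
  classical
  obtain ⟨G, _, hG⟩ := SimpleGraph.exists_isExtremal_free (V := Fin q) (treeT2_ne_bot (m := m) hm)
  have hc := SimpleGraph.card_edgeFinset_of_isExtremal_free hG
  have hle := SimpleGraph.card_edgeFinset_le_extremalNumber (treeT2_free_sum_top hm hG.prop)
  have hsum : #(G ⊕g (⊤ : SimpleGraph (Fin m))).edgeFinset =
      #G.edgeFinset + #(⊤ : SimpleGraph (Fin m)).edgeFinset := by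
    simp only [SimpleGraph.edgeFinset_card]
    rw [Fintype.card_congr SimpleGraph.edgeSetSumEquiv, Fintype.card_sum]
  rw [Fintype.card_fin] at hc
  simp only [Fintype.card_sum, Fintype.card_fin] at hle
  rw [hsum, hc, SimpleGraph.card_edgeFinset_top_eq_card_choose_two, Fintype.card_fin] at hle
  exact hle

open Classical in
theorem treeT2_free_of_degree_le {V : Type*} [Fintype V] {G : SimpleGraph V} {m : ℕ} (hm : 3 ≤ m)
    (hG : ∀ v, G.degree v + 3 ≤ m) : (treeT2 (m + 1)).Free G := by
  rintro ⟨f⟩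
  let g : Fin (m - 2) → V := fun j => f ⟨j + 1, by omega⟩
  have hg : Function.Injective g := fun i j hij => by
    have := congrArg Fin.val (f.injective hij)
    simp only at this
    ext; omega
  have hsub : univ.image g ⊆ G.neighborFinset (f 0) := by
    intro x hx
    obtain ⟨j, -, rfl⟩ := mem_image.1 hx
    rw [SimpleGraph.mem_neighborFinset]
    exact f.toHom.map_adj (treeT2_adj_zero rfl (by simp) (by simp; omega))
  have := card_le_card hsub
  rw [card_image_of_injective _ hg, card_univ, Fintype.card_fin,
    G.card_neighborFinset_eq_degree] at this
  have := hG (f 0)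
  omega

/-- The graph on `ZMod N` joining the elements at cyclic distance at most `e`. -/
def cyclicDistanceGraph (N e : ℕ) : SimpleGraph (ZMod N) :=
  SimpleGraph.circulantGraph {x | ∃ t : ℕ, 1 ≤ t ∧ t ≤ e ∧ x = t}

theorem cyclicDistanceGraph_adj {N e : ℕ} (he : e < N) {u v : ZMod N} :
    (cyclicDistanceGraph N e).Adj u v ↔ ∃ t : ℕ, 1 ≤ t ∧ t ≤ e ∧ (v = u + t ∨ v = u - t) := by
  have hne : ∀ t : ℕ, 1 ≤ t → t ≤ e → (t : ZMod N) ≠ 0 := fun t h1 h2 h => by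
    rw [ZMod.natCast_eq_zero_iff] at h
    have := Nat.le_of_dvd h1 h
    omega
  simp only [cyclicDistanceGraph, SimpleGraph.circulantGraph, SimpleGraph.fromRel_adj,
    Set.mem_ofPred_eq]
  constructor
  · rintro ⟨-, ⟨t, h1, h2, h⟩ | ⟨t, h1, h2, h⟩⟩
    · exact ⟨t, h1, h2, Or.inr (by rw [← h]; ring)⟩
    · exact ⟨t, h1, h2, Or.inl (by rw [← h]; ring)⟩
  · rintro ⟨t, h1, h2, rfl | rfl⟩
    · exact ⟨fun h => hne t h1 h2 (by simpa using h.symm), Or.inr ⟨t, h1, h2, by ring⟩⟩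
    · exact ⟨fun h => hne t h1 h2 (by simpa using h.symm), Or.inl ⟨t, h1, h2, by ring⟩⟩

open Classical in
theorem cyclicDistanceGraph_degree {N e : ℕ} [NeZero N] (he : 2 * e < N) (u : ZMod N) :
    (cyclicDistanceGraph N e).degree u = 2 * e := by
  have hcast : ∀ s t : ℕ, s < N → t < N → (s : ZMod N) = t → s = t := fun s t hs ht h => by
    rw [ZMod.natCast_eq_natCast_iff'] at h
    rwa [Nat.mod_eq_of_lt hs, Nat.mod_eq_of_lt ht] at h
  have hset : (cyclicDistanceGraph N e).neighborFinset u =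
      (Icc 1 e).image (fun t : ℕ => u + t) ∪ (Icc 1 e).image (fun t : ℕ => u - t) := by
    ext v
    rw [SimpleGraph.mem_neighborFinset, cyclicDistanceGraph_adj (by omega)]
    simp only [mem_union, mem_image, mem_Icc]
    constructor
    · rintro ⟨t, h1, h2, h | h⟩
      · exact Or.inl ⟨t, ⟨h1, h2⟩, h.symm⟩
      · exact Or.inr ⟨t, ⟨h1, h2⟩, h.symm⟩
    · rintro (⟨t, ⟨h1, h2⟩, h⟩ | ⟨t, ⟨h1, h2⟩, h⟩)
      · exact ⟨t, h1, h2, Or.inl h.symm⟩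
      · exact ⟨t, h1, h2, Or.inr h.symm⟩
  rw [← SimpleGraph.card_neighborFinset_eq_degree, hset, card_union_of_disjoint,
    card_image_of_injOn, card_image_of_injOn, Nat.card_Icc]
  · omega
  · intro s hs t ht h
    simp only [coe_Icc, Set.mem_Icc] at hs ht
    exact hcast s t (by omega) (by omega) (by simpa using h)
  · intro s hs t ht h
    simp only [coe_Icc, Set.mem_Icc] at hs ht
    exact hcast s t (by omega) (by omega) (by simpa using h)
  · rw [disjoint_left]
    intro v hvs hvt
    obtain ⟨s, hs, rfl⟩ := mem_image.1 hvs
    obtain ⟨t, ht, h⟩ := mem_image.1 hvt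
    rw [mem_Icc] at hs ht
    have : ((s + t : ℕ) : ZMod N) = (0 : ℕ) := by
      push_cast
      linear_combination -h
    have := hcast _ _ (by omega) (by omega) this
    omega

/-- The matching on `ZMod N` joining `j` and `j + N / 2` for `j < N / 2`. -/
def halfTurnMatching (N : ℕ) : SimpleGraph (ZMod N) :=
  SimpleGraph.fromRel fun u v => u.val < N / 2 ∧ v = u + (N / 2 : ℕ)

open Classical in
/-- For `d < N` there is a graph on `N` vertices with maximum degree at most `d` in which all
vertices but at most one have degree `d`, and the last one has degree at least `d - 1`. -/
theorem exists_almost_regular {N d : ℕ} (hd : d < N) :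
    ∃ (V : Type) (_ : Fintype V) (G : SimpleGraph V), Fintype.card V = N ∧
      (∀ v, G.degree v ≤ d) ∧ N * d ≤ 2 * #G.edgeFinset + 1 := by
  have : NeZero N := ⟨by omega⟩
  -- Even d: cyclic distance at most d / 2. Odd d: add the half-turn matching, which misses only -1,
  -- and only when N is odd.
  obtain ⟨e, rfl | rfl⟩ := Nat.even_or_odd' d
  · refine ⟨ZMod N, inferInstance, cyclicDistanceGraph N e, ZMod.card N,
      fun v => (cyclicDistanceGraph_degree hd v).le, ?_⟩
    rw [← SimpleGraph.sum_degrees_eq_twice_card_edges]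
    simp [cyclicDistanceGraph_degree hd]
  set h := N / 2 with hh
  have hval : ((h : ℕ) : ZMod N).val = h := ZMod.val_natCast_of_lt (by omega)
  have hvadd : ∀ v : ZMod N, v.val < h → (v + (h : ℕ)).val = v.val + h := fun v hv => by
    rw [ZMod.val_add_of_lt (by omega), hval]
  -- For odd N the value at -1 is not a matching partner; there it serves only in the upper bound on
  -- the degree.
  let p : ZMod N → ZMod N := fun u => if u.val < h then u + (h : ℕ) else u - (h : ℕ)
  have hMle : ∀ u v, (halfTurnMatching N).Adj u v → v = p u := fun u v huv => by
    rw [halfTurnMatching, SimpleGraph.fromRel_adj] at huv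
    rcases huv.2 with ⟨h1, h2⟩ | ⟨h1, h2⟩
    · simp only [p]; rw [if_pos h1, h2]
    · have := hvadd v h1
      simp only [p]
      rw [if_neg (by rw [h2, this]; omega), h2]
      ring
  have hMge : ∀ u, u ≠ -1 → (halfTurnMatching N).Adj u (p u) := fun u hu => by
    have hlt := ZMod.val_lt u
    have hu1 : u.val ≠ N - 1 := fun hu1 => hu (by
      rw [← ZMod.natCast_zmod_val u, hu1, Nat.cast_sub (by omega)]
      simp)
    rw [halfTurnMatching, SimpleGraph.fromRel_adj]
    simp only [p]
    have h0 : (h : ZMod N) ≠ 0 := fun h0 => by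
      rw [h0, ZMod.val_zero] at hval
      omega
    split_ifs with hc
    · exact ⟨by simpa using h0, Or.inl ⟨hc, rfl⟩⟩
    · refine ⟨fun hx => h0 ?_, Or.inr ⟨?_, by ring⟩⟩
      · linear_combination hx
      · have : u - (h : ℕ) = ((u.val - h : ℕ) : ZMod N) := by
          rw [Nat.cast_sub (by omega), ZMod.natCast_zmod_val]
        rw [this, ZMod.val_natCast_of_lt (by omega)]
        omega
  -- The matching shifts by h = N / 2 > e, so its edges are new.
  have hdisj : ∀ u, ¬ (cyclicDistanceGraph N e).Adj u (p u) := fun u hu => by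
    rw [cyclicDistanceGraph_adj (by omega)] at hu
    obtain ⟨t, h1, h2, ht⟩ := hu
    have hcases : ((h : ℕ) : ZMod N) = (t : ℕ) ∨ ((h + t : ℕ) : ZMod N) = (0 : ℕ) := by
      simp only [p] at ht
      push_cast
      split_ifs at ht <;> rcases ht with ht | ht
      · left; linear_combination ht
      · right; linear_combination ht
      · right; linear_combination -ht
      · left; linear_combination -ht
    rcases hcases with hc | hc <;> rw [ZMod.natCast_eq_natCast_iff'] at hc <;>
      rw [Nat.mod_eq_of_lt (by omega), Nat.mod_eq_of_lt (by omega)] at hc <;> omega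
  set C := cyclicDistanceGraph N e with hC
  obtain ⟨G, hG⟩ : ∃ G, G = C ⊔ halfTurnMatching N := ⟨_, rfl⟩
  have hCdeg : ∀ u, #(C.neighborFinset u) = 2 * e := fun u => by
    rw [SimpleGraph.card_neighborFinset_eq_degree]
    exact cyclicDistanceGraph_degree (by omega) u
  have hle : ∀ u, G.degree u ≤ 2 * e + 1 := fun u => by
    rw [← hCdeg u, ← SimpleGraph.card_neighborFinset_eq_degree]
    refine (card_le_card fun v hv => ?_).trans (card_insert_le (p u) _)
    rw [SimpleGraph.mem_neighborFinset, hG, SimpleGraph.sup_adj] at hv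
    rcases hv with hv | hv
    · simp [hv]
    · simp [hMle u v hv]
  have hge' : ∀ u, 2 * e ≤ G.degree u := fun u => by
    rw [← hCdeg u, ← SimpleGraph.card_neighborFinset_eq_degree]
    refine card_le_card fun v hv => ?_
    rw [SimpleGraph.mem_neighborFinset] at hv ⊢
    exact hG ▸ Or.inl hv
  have hge : ∀ u, u ≠ -1 → 2 * e + 1 ≤ G.degree u := fun u hu => by
    rw [← hCdeg u, ← SimpleGraph.card_neighborFinset_eq_degree,
      ← card_insert_of_notMem (a := p u) (by simpa using hdisj u)]
    refine card_le_card fun v hv => ?_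
    rw [SimpleGraph.mem_neighborFinset, hG]
    rcases mem_insert.1 hv with rfl | hv
    · exact Or.inr (hMge u hu)
    · exact Or.inl (by simpa using hv)
  refine ⟨ZMod N, ZMod.fintype N, G, ZMod.card N, hle, ?_⟩
  rw [← SimpleGraph.sum_degrees_eq_twice_card_edges, ← add_sum_erase _ _ (mem_univ (-1))]
  have h1 : #(univ.erase (-1 : ZMod N)) • (2 * e + 1) ≤ ∑ u ∈ univ.erase (-1), G.degree u :=
    card_nsmul_le_sum _ _ _ fun u hu => hge u (ne_of_mem_erase hu)
  rw [card_erase_of_mem (mem_univ _), card_univ, ZMod.card, smul_eq_mul] at h1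
  have h2 := hge' (-1)
  obtain ⟨M, rfl⟩ : ∃ M, N = M + 1 := ⟨N - 1, by omega⟩
  simp only [Nat.add_sub_cancel] at h1
  have h3 : (M + 1) * (2 * e + 1) = M * (2 * e + 1) + (2 * e + 1) := by ring
  omega

/-! ### Lower bounds for the extremal number -/

theorem two_mul_choose_two_add (m : ℕ) : 2 * m.choose 2 + m = m * m := by
  rw [Nat.choose_two_right, Nat.mul_div_cancel' (Nat.even_mul_pred_self m).two_dvd]
  cases m with
  | zero => rfl
  | succ m => simp only [Nat.add_sub_cancel]; ring

theorem choose_two_le_extremalNumber_treeT2 {m r : ℕ} (hr : r ≤ m) :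
    r.choose 2 ≤ SimpleGraph.extremalNumber r (treeT2 (m + 1)) := by
  classical
  have hfree : (treeT2 (m + 1)).Free (⊤ : SimpleGraph (Fin r)) := by
    rintro ⟨f⟩
    have := Fintype.card_le_of_injective f.toHom f.injective
    simp at this
    omega
  have := SimpleGraph.card_edgeFinset_le_extremalNumber hfree
  rwa [SimpleGraph.card_edgeFinset_top_eq_card_choose_two, Fintype.card_fin] at this

theorem clique_bound_le_extremalNumber_treeT2 {m r s : ℕ} (hm : 3 ≤ m) (hrs : r + s = m) (k : ℕ) :
    m * (k * m + r) ≤ 2 * SimpleGraph.extremalNumber (k * m + r) (treeT2 (m + 1)) +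
      r * s + (k * m + r) := by
  induction k with
  | zero =>
    have h1 := choose_two_le_extremalNumber_treeT2 (m := m) (r := r) (by omega)
    have h2 := two_mul_choose_two_add r
    have h3 : m * r = r * r + r * s := by rw [← hrs]; ring
    simp only [zero_mul, zero_add]
    omega
  | succ k ih =>
    have h1 := extremalNumber_treeT2_add hm (k * m + r)
    have h2 := two_mul_choose_two_add m
    have h3 : (k + 1) * m + r = k * m + r + m := by ring
    rw [h3, mul_add]
    omega

/-- An almost (m - 3)-regular graph on m + r vertices settles k = 1; each further step adds a K_m.
The final 1 is the parity loss. -/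
theorem regular_bound_le_extremalNumber_treeT2 {m r : ℕ} (hm : 3 ≤ m) {k : ℕ} (hk : 1 ≤ k) :
    m * (k * m + r) ≤ 2 * SimpleGraph.extremalNumber (k * m + r) (treeT2 (m + 1)) +
      2 * (m + r) + (k * m + r) + 1 := by
  classical
  induction k, hk using Nat.le_induction with
  | base =>
    obtain ⟨V, _, G, hV, hdeg, hE⟩ := exists_almost_regular (N := m + r) (d := m - 3) (by omega)
    have h1 := SimpleGraph.card_edgeFinset_le_extremalNumber
      (treeT2_free_of_degree_le (G := G) hm fun v => by have := hdeg v; omega)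
    rw [hV] at h1
    obtain ⟨l, rfl⟩ : ∃ l, m = l + 3 := ⟨m - 3, by omega⟩
    rw [Nat.add_sub_cancel] at hE
    have h2 : (l + 3) * (l + 3 + r) = (l + 3 + r) * l + 3 * (l + 3 + r) := by ring
    rw [one_mul]
    omega
  | succ k _ ih =>
    have h1 := extremalNumber_treeT2_add hm (k * m + r)
    have h2 := two_mul_choose_two_add m
    have h3 : (k + 1) * m + r = k * m + r + m := by ring
    rw [h3, mul_add]
    omega

theorem extremalNumber_treeT2_upper {m : ℕ} (hm : 4 ≤ m) {k r s : ℕ} (hs : 1 ≤ s)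
    (hrs : r + s = m) {p : ℕ} (hp : p = k * m + r) :
    2 * SimpleGraph.extremalNumber p (treeT2 (m + 1)) + r * s + p ≤ m * p ∨
      2 * SimpleGraph.extremalNumber p (treeT2 (m + 1)) + 2 * (m + r) + p ≤ m * p := by
  classical
  obtain ⟨G, _, hG⟩ := SimpleGraph.exists_isExtremal_free (V := Fin p)
    (treeT2_ne_bot (m := m) (by omega))
  have hc := SimpleGraph.card_edgeFinset_of_isExtremal_free hG
  have := twice_card_edgeFinset_le_of_treeT2_free hm hG.prop hs hrs
    (by rw [Fintype.card_fin, hp])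
  rw [Fintype.card_fin] at this hc
  rw [← hc]
  rcases this with h | ⟨-, h⟩
  · left; convert h
  · right; convert h

/-! ### Comparing the two bounds -/

theorem regular_bound_of_range {m r s k p : ℕ} (hrs : r + s = m) (hp : p = k * m + r)
    (h : (15 ≤ m ∧ 3 ≤ r ∧ 5 ≤ s) ∨ (12 ≤ m ∧ m ≤ 14 ∧ 4 ≤ r ∧ 6 ≤ s)) :
    2 * (m + r) + ((m - 1) * p) % 2 ≤ r * s := by
  have hmod := Nat.mod_lt ((m - 1) * p) two_pos
  rcases h with ⟨h1, h2, h3⟩ | ⟨h1, h2, h3, h4⟩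
  · obtain ⟨a, rfl⟩ := Nat.exists_eq_add_of_le h2
    obtain ⟨b, rfl⟩ := Nat.exists_eq_add_of_le h3
    -- Here (r - 2)(s - 4) ≥ m - 7. At m = 15 this is exactly 8, and the parity term vanishes since
    -- m - 1 is even.
    rcases eq_or_lt_of_le h1 with h15 | h16
    · have : ((m - 1) * p) % 2 = 0 := by rw [← h15]; omega
      rw [this]
      nlinarith
    · nlinarith
  · interval_cases m
    -- For m = 12, equality holds at r = 4 and r = 6, where p is even; r = 5 leaves one unit for
    -- parity.
    · have : r = 4 ∨ r = 5 ∨ r = 6 := by omega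
      rcases this with rfl | rfl | rfl
      · obtain rfl : s = 8 := by omega
        omega
      · obtain rfl : s = 7 := by omega
        omega
      · obtain rfl : s = 6 := by omega
        omega
    · obtain ⟨a, rfl⟩ := Nat.exists_eq_add_of_le h3
      obtain ⟨b, rfl⟩ := Nat.exists_eq_add_of_le h4
      nlinarith
    · obtain ⟨a, rfl⟩ := Nat.exists_eq_add_of_le h3
      obtain ⟨b, rfl⟩ := Nat.exists_eq_add_of_le h4
      nlinarith

theorem clique_bound_of_not_range {m r s : ℕ} (hrs : r + s = m) (hs : 1 ≤ s)
    (h : ¬ ((15 ≤ m ∧ 3 ≤ r ∧ 5 ≤ s) ∨ (12 ≤ m ∧ m ≤ 14 ∧ 4 ≤ r ∧ 6 ≤ s))) :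
    r * s ≤ 2 * (m + r) := by
  by_cases hr : r ≤ 2
  · interval_cases r <;> omega
  by_cases hs4 : s ≤ 4
  · interval_cases s <;> omega
  have hm : m ≤ 14 := by omega
  by_cases hr3 : r = 3
  · subst hr3; omega
  by_cases hs5 : s = 5
  · subst hs5; omega
  have hr7 : r ≤ 7 := by omega
  interval_cases r <;> omega

theorem theorem3p1 (p n k r : ℕ) (hn : 4 ≤ n - 1) (hp : n - 1 ≤ p) (hk : 1 ≤ k)
    (hr : r ≤ n - 2) (hpkr : p = k * (n - 1) + r) :
    (SimpleGraph.extremalNumber p (treeT2 n) : ℚ) =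
        max ((⌊((n : ℚ) - 2) * p / 2⌋ : ℚ) - ((n : ℚ) - 1 + r))
          ((((n : ℚ) - 2) * p - r * ((n : ℚ) - 1 - r)) / 2) ∧
      (SimpleGraph.extremalNumber p (treeT2 n) : ℚ) =
        if (16 ≤ n ∧ 3 ≤ r ∧ r ≤ n - 6) ∨ (13 ≤ n ∧ n ≤ 15 ∧ 4 ≤ r ∧ r ≤ n - 7) then
          (⌊((n : ℚ) - 2) * p / 2⌋ : ℚ) - ((n : ℚ) - 1 + r)
        else
          (((n : ℚ) - 2) * p - r * ((n : ℚ) - 1 - r)) / 2 := by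
  obtain ⟨m, rfl⟩ : ∃ m, n = m + 1 := ⟨n - 1, by omega⟩
  rw [Nat.add_sub_cancel] at hn hp hpkr
  obtain ⟨s, hrs⟩ : ∃ s, r + s = m := ⟨m - r, by omega⟩
  have hs : 1 ≤ s := by omega
  have hup := extremalNumber_treeT2_upper hn hs hrs hpkr
  have hlo := clique_bound_le_extremalNumber_treeT2 (by omega) hrs k
  have hlo' := regular_bound_le_extremalNumber_treeT2 (m := m) (r := r) (by omega) hk
  have hrange := regular_bound_of_range (k := k) hrs hpkr
  have hnrange := clique_bound_of_not_range hrs hs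
  rw [← hpkr] at hlo hlo'
  set E := SimpleGraph.extremalNumber p (treeT2 (m + 1))
  -- Q = (n - 2)p as one atom keeps the remaining natural-number arithmetic linear.
  obtain ⟨Q, hQ⟩ : ∃ Q, Q = (m - 1) * p := ⟨_, rfl⟩
  have hmp : m * p = Q + p := by
    obtain ⟨l, rfl⟩ : ∃ l, m = l + 1 := ⟨m - 1, by omega⟩
    rw [hQ, Nat.add_sub_cancel]
    ring
  rw [← hQ] at hrange
  rw [hmp] at hup hlo hlo'
  have hQq : (((m + 1 : ℕ) : ℚ) - 2) * p = Q := by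
    have : (m : ℚ) * p = Q + p := by exact_mod_cast hmp
    push_cast
    linarith
  have hfloor : ⌊(Q : ℚ) / 2⌋ = ((Q / 2 : ℕ) : ℤ) := by
    exact_mod_cast Rat.floor_natCast_div_natCast Q 2
  have hsq : ((m + 1 : ℕ) : ℚ) - 1 - r = s := by
    rw [← hrs]; push_cast; ring
  have hmq : ((m + 1 : ℕ) : ℚ) - 1 + r = (m + r : ℕ) := by
    push_cast; ring
  have hA : ∀ {x : ℕ}, ((⌊(Q : ℚ) / 2⌋ : ℤ) : ℚ) - (x : ℚ) = (((Q / 2 : ℕ) : ℤ) - x : ℤ) :=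
    fun {x} => by rw [hfloor]; push_cast; ring
  have hle1 : (((Q / 2 : ℕ) : ℤ) - (m + r : ℕ) : ℤ) ≤ (E : ℤ) := by omega
  have hle2 : ((Q : ℚ) - r * s) / 2 ≤ E := by
    have : (Q : ℚ) ≤ 2 * E + r * s := by exact_mod_cast (by omega : Q ≤ 2 * E + r * s)
    linarith
  have hge1 : 2 * E + 2 * (m + r) ≤ Q →
      (E : ℚ) = ((((Q / 2 : ℕ) : ℤ) - (m + r : ℕ) : ℤ) : ℚ) := fun h => by
    exact_mod_cast (by omega : (E : ℤ) = ((Q / 2 : ℕ) : ℤ) - (m + r : ℕ))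
  have hge2 : 2 * E + r * s ≤ Q → (E : ℚ) = ((Q : ℚ) - r * s) / 2 := fun h => by
    have : (2 : ℚ) * E + r * s ≤ Q := by exact_mod_cast h
    linarith
  have hle1' : ((((Q / 2 : ℕ) : ℤ) - (m + r : ℕ) : ℤ) : ℚ) ≤ E := by exact_mod_cast hle1
  rw [hQq, hsq, hmq, hA]
  constructor
  · rcases hup with h | h
    · rw [← hge2 (by omega), max_eq_right hle1']
    · rw [← hge1 (by omega), max_eq_left hle2]
  · split_ifs with hc
    -- The parity term can be dropped: integrality of E supplies the rounding.
    · have := (Nat.le_add_right _ _).trans (hrange (by omega))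
      refine hge1 ?_
      rcases hup with h | h <;> linarith
    · have := hnrange (by omega)
      refine hge2 ?_
      rcases hup with h | h <;> linarith
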